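/- Let $p$ be a prime, $q$ a power of $p$, $k=\mathbb F_q(T)$, and let $\mathfrak p_\infty$ be the infinite place of $k$ (the pole of $T$). Write $\wp(\mathbb F_q)=\{a^p-a : a\in\mathbb F_q\}$, let $W_n$ denote Witt vectors of length $n$ (for the prime $p$), and for $\vec y=(y_1,\dots,y_n)$ put $\vec y^{\,p}=(y_1^p,\dots,y_n^p)$. Let $K/k$ be a cyclic extension of degree $p^n$ with $\operatorname{Gal}(K/k)=\langle\sigma\rangle$, and suppose that $K=k(y_1,\dots,y_n)$ for some $\vec y\in W_n(K)$ such that, for the Witt vector operations, $$\vec y^{\,p}-\vec y=\vec\beta=\vec\delta_1+\cdots+\vec\delta_r+\vec\mu ,$$ where, for distinct monic irreducible polynomials $P_1,\dots,P_r\in\mathbb F_q[T]$, the components are $\delta_{ij}=Q_{ij}/P_i^{e_{ij}}$ with $Q_{ij}\in\mathbb F_q[T]$, $e_{ij}\ge 0$ and $\deg Q_{ij}<\deg P_i^{e_{ij}}$ (so $\delta_{ij}=0$ if $e_{ij}=0$), and $p\nmid e_{ij}$, $\gcd(Q_{ij},P_i)=1$ if $e_{ij}>0$; and $\mu_j=f_j(T)\in\mathbb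 F_q[T]$ with $p\nmid\deg f_j$ whenever $f_j\notin\mathbb F_q$. Let $0\le s\le t\le n$ be such that $\mu_1=\cdots=\mu_s=0$; if $s<t$, then $\mu_{s+1}\in\mathbb F_q\setminus\wp(\mathbb F_q)$; $\mu_1,\dots,\mu_t\in\mathbb F_q$; and if $t<n$, then $f_{t+1}\notin\mathbb F_q$ (so $t+1$ is the first index with nonconstant $f_{t+1}$, and $t=n$ if there is none). Then $\mathfrak p_\infty$ has ramification index $p^{n-t}$, inertia degree $p^{t-s}$ and decomposition number (number of places of $K$ above $\mathfrak p_\infty$) $p^s$. For every place of $K$ above $\mathfrak p_\infty$ the inertia group is $\langle\sigma^{p^t}\rangle$ and the decomposition group is $\langle\sigma^{p^s}\rangle$. -/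

import Mathlib

open scoped Polynomial Pointwise

noncomputable section

namespace WittExt

/-- The coefficientwise `p`-th power `(y₁, …, yₙ) ↦ (y₁ ^ p, …, yₙ ^ p)` of a Witt vector of
length `n`. -/
def powP {p n : ℕ} {R : Type*} [CommRing R] (y : TruncatedWittVector p n R) :
    TruncatedWittVector p n R :=
  TruncatedWittVector.mk p fun j => y.coeff j ^ p

/-- The image in `W_n(S)` of a Witt vector in `W_n(R)`, for an `R`-algebra `S`. -/
def mapCoeff {p n : ℕ} {R : Type*} (S : Type*) [CommRing R] [CommRing S] [Algebra R S]
    (x : TruncatedWittVector p n R) : TruncatedWittVector p n S :=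
  TruncatedWittVector.mk p fun j => algebraMap R S (x.coeff j)

/-- `℘(F) = {a ^ p - a | a ∈ F}`. -/
def artinSchreierImage (p : ℕ) (F : Type*) [Field F] : Set F :=
  Set.range fun a : F => a ^ p - a

/-- The data of a decomposition in normal form: distinct monic irreducible polynomials
`P₁, …, P_r`, reduced proper fractions `δ i j = Q i j / P i ^ e i j` whose pole order `e i j` is
prime to `p` when positive, and polynomials `f j` of degree prime to `p` when nonconstant.
The components of the Witt vectors are indexed by `Fin n`, starting from `0`. -/
structure NormalForm (p : ℕ) (F : Type*) [Field F] (n r : ℕ) where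
  P : Fin r → F[X]
  Q : Fin r → Fin n → F[X]
  e : Fin r → Fin n → ℕ
  f : Fin n → F[X]
  monic : ∀ i, (P i).Monic
  irreducible : ∀ i, Irreducible (P i)
  injective : Function.Injective P
  /-- For `e i j = 0` this says that `Q i j = 0`, so that `δ i j = 0`. -/
  degree_lt : ∀ i j, (Q i j).degree < (P i ^ e i j).degree
  not_dvd : ∀ i j, 0 < e i j → ¬ p ∣ e i j
  coprime : ∀ i j, 0 < e i j → IsCoprime (Q i j) (P i)
  not_dvd_natDegree : ∀ j, 0 < (f j).natDegree → ¬ p ∣ (f j).natDegree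

namespace NormalForm

variable {p : ℕ} {F : Type*} [Field F] {n r : ℕ} (N : NormalForm p F n r)

/-- The Witt vector `δ_i = (Q_{i1} / P_i ^ e_{i1}, …, Q_{in} / P_i ^ e_{in})` over `F(T)`. -/
def delta (i : Fin r) : TruncatedWittVector p n (RatFunc F) :=
  TruncatedWittVector.mk p fun j =>
    algebraMap F[X] (RatFunc F) (N.Q i j) / algebraMap F[X] (RatFunc F) (N.P i ^ N.e i j)

/-- The Witt vector `μ = (f₁(T), …, fₙ(T))` over `F(T)`. -/
def mu : TruncatedWittVector p n (RatFunc F) :=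
  TruncatedWittVector.mk p fun j => algebraMap F[X] (RatFunc F) (N.f j)

/-- The Witt vector sum `β = δ₁ + ⋯ + δ_r + μ` in `W_n(F(T))`. -/
def beta [Fact p.Prime] : TruncatedWittVector p n (RatFunc F) :=
  ∑ i, N.delta i + N.mu

end NormalForm

open Classical in
/-- The valuation ring of the infinite place `𝔭_∞` (the pole of `T`) of `F(T)`. -/
abbrev inftyRing (F : Type*) [Field F] : ValuationSubring (RatFunc F) :=
  (RatFunc.inftyValuation F).valuationSubring

/-- The maximal ideal `𝔭_∞` of the valuation ring of the infinite place of `F(T)`. -/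
abbrev primeInfty (F : Type*) [Field F] : Ideal (inftyRing F) :=
  IsLocalRing.maximalIdeal (inftyRing F)

/-- The integral closure in `K` of the valuation ring of the infinite place. For `K / F(T)` finite
its prime ideals over `primeInfty F` are the places of `K` above `𝔭_∞`. -/
abbrev inftyIntegers (F : Type*) [Field F] (K : Type*) [Field K] [Algebra (RatFunc F) K] :
    Subalgebra (inftyRing F) K :=
  integralClosure (inftyRing F) K

instance smulCommClass_inftyRing (F : Type*) [Field F] (K : Type*) [Field K]
    [Algebra (RatFunc F) K] : SMulCommClass Gal(K/RatFunc F) (inftyRing F) K :=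
  ⟨fun g a x => by
    change g ((a : RatFunc F) • x) = (a : RatFunc F) • g x
    exact map_smul g _ _⟩

/-- The Galois group acts on the integral closure by restriction of its action on `K`. -/
instance mulSemiringActionInftyIntegers (F : Type*) [Field F] (K : Type*) [Field K]
    [Algebra (RatFunc F) K] : MulSemiringAction Gal(K/RatFunc F) (inftyIntegers F K) :=
  inferInstance

instance mulActionIdealInftyIntegers (F : Type*) [Field F] (K : Type*) [Field K]
    [Algebra (RatFunc F) K] : MulAction Gal(K/RatFunc F) (Ideal (inftyIntegers F K)) :=
  Ideal.pointwiseDistribMulAction.toMulAction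

end WittExt

end

/-! Number components from 0 and let H_m (`levelSubgroup`) fix y_0, …, y_{m-1}. Comparing
components, y_m^p - y_m is an integer polynomial in the earlier y_i and in β (`carry`), so an
element of H_m moves y_m by an element of 𝔽_p, and H_{m+1} has index at most p in H_m. Since |H_0| =
p^n and H_n = 1, every index is p and H_m = ⟨σ^{p^m}⟩. A cyclic p-group has no other subgroups, so S
= H_m as soon as S ≤ H_m and, when m < n, S is not contained in H_{m+1} (`eq_levelSubgroup`).

Let P lie above 𝔭_∞, with inertia group I and decomposition group D. The δ_i vanish at infinity, so
y_0, …, y_{t-1} are integral there. A difference g y_j - y_j in 𝔽_p is 0 once it lies in P, whence I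
≤ H_t. If I ≤ H_{t+1}, then y_t lies in a subfield unramified below P, although y_t^p - y_t has a
pole of order deg f_t prime to p (`dvd_natDegree_of_inertia_le`). So I = H_t.

For j < s the residue of y_j is a root of X^p - X, hence in 𝔽_p and fixed by D; so D ≤ H_s. If s <
t, the residue of y_s solves X^p - X = c with c ∉ ℘(𝔽_q), so it is not in 𝔽_q and D moves it
(`not_stabilizer_le_levelSubgroup`); if s = t, use D ≥ I = H_t. So D = H_s. The numbers follow from
e = |I|, ef = |D|, efg = p^n. -/

noncomputable section

/-! ### Components of sums of Witt vectors -/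

namespace WittVector

variable {p : ℕ} [Fact p.Prime] {R S : Type*} [CommRing R] [CommRing S]

omit [Fact p.Prime] in
theorem coeff_init_of_lt {n i : ℕ} (h : i < n) (x : WittVector p R) :
    (init n x).coeff i = x.coeff i := by
  simp [init, select, h]

omit [Fact p.Prime] in
theorem coeff_init_of_le {n i : ℕ} (h : n ≤ i) (x : WittVector p R) :
    (init n x).coeff i = 0 := by
  simp [init, select, h.not_gt]

omit [Fact p.Prime] in
theorem coeff_tail_of_lt {n i : ℕ} (h : i < n) (x : WittVector p R) :
    (tail n x).coeff i = 0 := by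
  simp [tail, select, h.not_ge]

omit [Fact p.Prime] in
theorem coeff_tail_of_le {n i : ℕ} (h : n ≤ i) (x : WittVector p R) :
    (tail n x).coeff i = x.coeff i := by
  simp [tail, select, h]

theorem map_init (f : R →+* S) (n : ℕ) (x : WittVector p R) :
    map f (init n x) = init n (map f x) := by
  ext i
  rcases lt_or_ge i n with h | h
  · simp [coeff_init_of_lt h]
  · simp [coeff_init_of_le h]

theorem truncate_eq_iff {n : ℕ} {x y : WittVector p R} :
    truncate n x = truncate n y ↔ ∀ i < n, x.coeff i = y.coeff i := by
  refine ⟨fun h i hi => ?_, fun h => ?_⟩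
  · simpa using congr_arg (TruncatedWittVector.coeff ⟨i, hi⟩) h
  · ext i
    simpa using h i i.2

theorem iterate_verschiebung_add (m : ℕ) (x y : WittVector p R) :
    verschiebung^[m] (x + y) = verschiebung^[m] x + verschiebung^[m] y := by
  induction m generalizing x y with
  | zero => rfl
  | succ m ih => simp only [Function.iterate_succ_apply, map_add, ih]

/-- Adding a Witt vector whose first `m` components vanish adds its component `m`. -/
theorem coeff_add_of_forall_lt_eq_zero {m : ℕ} (x : WittVector p R) {z : WittVector p R}
    (hz : ∀ i < m, z.coeff i = 0) : (x + z).coeff m = x.coeff m + z.coeff m := by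
  set c : WittVector p R := z.shift m
  set d : WittVector p R := (tail m x).shift m
  have hc : verschiebung^[m] c = z := (eq_iterate_verschiebung hz).symm
  have hd : verschiebung^[m] d = tail m x :=
    (eq_iterate_verschiebung fun i hi => coeff_tail_of_lt hi x).symm
  -- Both `z` and the tail of `x` lie in the image of the additive map V^m. Adding `init m x` to
  -- such a vector is componentwise because the supports are disjoint, and component 0 of a Witt
  -- vector sum is the plain sum.
  have key : x + z = init m x + verschiebung^[m] (d + c) := by
    rw [iterate_verschiebung_add, hc, hd, ← add_assoc, init_add_tail]
  have h0 : (verschiebung^[m] (d + c)).coeff m = (d + c).coeff 0 := by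
    simpa using iterate_verschiebung_coeff (d + c) m 0
  rw [key, coeff_add_of_disjoint, h0, coeff_init_of_le le_rfl, zero_add, add_coeff_zero]
  · simp [c, d, shift_coeff, coeff_tail_of_le le_rfl]
  · intro i
    rcases lt_or_ge i m with h | h
    · exact Or.inr (iterate_verschiebung_coeff_eq_zero _ h)
    · exact Or.inl (coeff_init_of_le h x)

theorem coeff_add_congr {m : ℕ} {x x' y y' : WittVector p R}
    (hx : ∀ i < m, x.coeff i = x'.coeff i) (hy : ∀ i < m, y.coeff i = y'.coeff i) :
    ∀ i < m, (x + y).coeff i = (x' + y').coeff i := by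
  rw [← truncate_eq_iff] at *
  rw [map_add, map_add, hx, hy]

/-- The component `m` of `y + b`, up to the linear term in the component `m` of `y`. -/
def carry (m : ℕ) (y b : WittVector p R) : R :=
  (init m y + b).coeff m

theorem coeff_add_eq_carry (m : ℕ) (y b : WittVector p R) :
    (y + b).coeff m = carry m y b + y.coeff m := by
  have h : y + b = init m y + b + tail m y := by
    rw [add_right_comm, init_add_tail]
  rw [h, coeff_add_of_forall_lt_eq_zero _ fun i hi => coeff_tail_of_lt hi y,
    coeff_tail_of_le le_rfl, carry]

theorem map_carry (f : R →+* S) (m : ℕ) (y b : WittVector p R) :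
    f (carry m y b) = carry m (map f y) (map f b) := by
  rw [carry, carry, ← map_init, ← map_add, map_coeff]

/-- Only components of `y` strictly below `m` matter, while component `m` of `b` still enters; this
permits induction on components. -/
theorem carry_congr {m : ℕ} {y y' b b' : WittVector p R}
    (hy : ∀ i < m, y.coeff i = y'.coeff i) (hb : ∀ i < m + 1, b.coeff i = b'.coeff i) :
    carry m y b = carry m y' b' := by
  refine coeff_add_congr (m := m + 1) (fun i _ => ?_) hb m m.lt_succ_self
  rcases lt_or_ge i m with h | h
  · simp [coeff_init_of_lt h, hy i h]
  · simp [coeff_init_of_le h]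

theorem carry_add_of_forall_lt_eq_zero {m : ℕ} (y b : WittVector p R) {z : WittVector p R}
    (hz : ∀ i < m, z.coeff i = 0) : carry m y (b + z) = carry m y b + z.coeff m := by
  rw [carry, carry, ← add_assoc, coeff_add_of_forall_lt_eq_zero _ hz]

theorem carry_of_forall_lt_eq_zero {m : ℕ} (y : WittVector p R) {b : WittVector p R}
    (hb : ∀ i < m, b.coeff i = 0) : carry m y b = b.coeff m := by
  rw [carry, coeff_add_of_forall_lt_eq_zero _ hb, coeff_init_of_le le_rfl, zero_add]

end WittVector

/-! ### Subgroups of a cyclic p-group and the level filtration -/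

theorem IsCyclic.subgroup_eq_of_card_eq {G : Type*} [Group G] [Finite G] [IsCyclic G]
    {S T : Subgroup G} (h : Nat.card S = Nat.card T) : S = T := by
  classical
  have := Fintype.ofFinite G
  -- A cyclic group has at most d solutions of a^d = 1, so a subgroup of order d is the whole
  -- solution set.
  have key : ∀ U : Subgroup G, Nat.card U = Nat.card T →
      (U : Set G) = ((Finset.univ.filter fun a : G => a ^ Nat.card T = 1 : Finset G) : Set G) := by
    intro U hU
    have hsub : (U : Set G).toFinset ⊆ Finset.univ.filter fun a : G => a ^ Nat.card T = 1 := by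
      intro a ha
      have ha' : a ∈ U := by simpa using ha
      rw [Finset.mem_filter, ← hU]
      exact ⟨Finset.mem_univ a, congr_arg Subtype.val (pow_card_eq_one' (x := (⟨a, ha'⟩ : U)))⟩
    have hle := IsCyclic.card_pow_eq_one_le (α := G) (n := Nat.card T) Nat.card_pos
    have hcard : (U : Set G).toFinset.card = Nat.card T := by
      rw [Set.toFinset_card, ← Nat.card_eq_fintype_card, ← hU]
      rfl
    rw [← Finset.eq_of_subset_of_card_le hsub (hle.trans hcard.ge), Set.coe_toFinset]
  exact SetLike.coe_injective ((key S h).trans (key T rfl).symm)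

namespace WittExt

section tower

variable {k K : Type*} [Field k] [Field K] [Algebra k K]

/-- The automorphisms fixing `y 0, …, y (m - 1)`. -/
def levelSubgroup (k : Type*) {K : Type*} [Field k] [Field K] [Algebra k K] (y : ℕ → K) (m : ℕ) :
    Subgroup Gal(K/k) where
  carrier := {g | ∀ j < m, g (y j) = y j}
  one_mem' := by simp
  mul_mem' := by
    intro a b ha hb j hj
    rw [AlgEquiv.mul_apply, hb j hj, ha j hj]
  inv_mem' := by
    intro a ha j hj
    exact (AlgEquiv.symm_apply_eq a).2 (ha j hj).symm

theorem mem_levelSubgroup {y : ℕ → K} {m : ℕ} {g : Gal(K/k)} :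
    g ∈ levelSubgroup k y m ↔ ∀ j < m, g (y j) = y j :=
  Iff.rfl

theorem levelSubgroup_zero (y : ℕ → K) : levelSubgroup k y 0 = ⊤ :=
  eq_top_iff.2 fun _ _ _ hj => absurd hj (Nat.not_lt_zero _)

theorem levelSubgroup_anti (y : ℕ → K) : Antitone (levelSubgroup k y) :=
  fun _ _ h _ hg j hj => hg j (hj.trans_le h)

theorem mem_levelSubgroup_succ {y : ℕ → K} {m : ℕ} {g : Gal(K/k)} :
    g ∈ levelSubgroup k y (m + 1) ↔ g ∈ levelSubgroup k y m ∧ g (y m) = y m := by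
  simp only [mem_levelSubgroup, Nat.lt_succ_iff_lt_or_eq]
  exact ⟨fun h => ⟨fun j hj => h j (Or.inl hj), h m (Or.inr rfl)⟩,
    fun h j hj => hj.elim (h.1 j) fun e => e ▸ h.2⟩

variable {p : ℕ} [Fact p.Prime] [CharP K p]

theorem exists_intCast_eq_of_pow_eq_self {x : K} (hx : x ^ p = x) : ∃ a : ℤ, (a : K) = x :=
  (_root_.mem_bot_iff_intCast p K).1 ((Subfield.mem_bot_iff_pow_eq_self K p).2 hx)

variable (p) in
theorem card_pow_eq_self : Nat.card {x : K // x ^ p = x} = p := by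
  have : {x : K | x ^ p = x} = (⊥ : Subfield K) :=
    Set.ext fun x => (Subfield.mem_bot_iff_pow_eq_self K p).symm
  exact (congr_arg (fun s : Set K => Nat.card s) this).trans (Subfield.card_bot K p)

/-- The map g ↦ g(y_m) - y_m embeds the cosets into the p roots of X^p - X. -/
theorem relIndex_levelSubgroup_le {y : ℕ → K} {m : ℕ}
    (h : ∀ g ∈ levelSubgroup k y m, (g (y m) - y m) ^ p = g (y m) - y m) :
    (levelSubgroup k y (m + 1)).relIndex (levelSubgroup k y m) ≤ p := by
  let f : levelSubgroup k y m ⧸ (levelSubgroup k y (m + 1)).subgroupOf (levelSubgroup k y m) →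
      {x : K // x ^ p = x} :=
    Quotient.lift (fun g => ⟨g.1 (y m) - y m, h g.1 g.2⟩) (by
      intro a b hab
      have hab' := QuotientGroup.leftRel_apply.1 hab
      have := (mem_levelSubgroup_succ.1 (Subgroup.mem_subgroupOf.1 hab')).2
      simp only [Subgroup.coe_mul, Subgroup.coe_inv, AlgEquiv.mul_apply] at this
      have e : b.1 (y m) = a.1 (y m) := (AlgEquiv.symm_apply_eq a.1).1 this
      simp [e])
  have hf : Function.Injective f := by
    intro a b
    induction a using QuotientGroup.induction_on with | _ a
    induction b using QuotientGroup.induction_on with | _ b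
    intro hab
    have e : a.1 (y m) = b.1 (y m) := sub_left_injective (congr_arg Subtype.val hab)
    refine QuotientGroup.eq.2 (Subgroup.mem_subgroupOf.2 (mem_levelSubgroup_succ.2
      ⟨(a⁻¹ * b).2, ?_⟩))
    simp only [Subgroup.coe_mul, Subgroup.coe_inv, AlgEquiv.mul_apply]
    exact (AlgEquiv.symm_apply_eq a.1).2 e.symm
  have hp : Nat.card {x : K // x ^ p = x} = p := card_pow_eq_self p
  have : Finite {x : K // x ^ p = x} :=
    Nat.finite_of_card_ne_zero (by rw [hp]; exact (Fact.out : p.Prime).ne_zero)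
  exact (Nat.card_le_card_of_injective f hf).trans hp.le

variable [FiniteDimensional k K] {n : ℕ} {y : ℕ → K}

-- Going from order p^n to order 1 in n steps of index at most p forces every index to be p: `up`
-- bounds the order below from the top, `down` bounds it above from the bottom.
omit [FiniteDimensional k K] in
theorem card_levelSubgroup (hcard : Nat.card Gal(K/k) = p ^ n) (hbot : levelSubgroup k y n = ⊥)
    (h : ∀ m < n, ∀ g ∈ levelSubgroup k y m, (g (y m) - y m) ^ p = g (y m) - y m)
    {m : ℕ} (hm : m ≤ n) : Nat.card (levelSubgroup k y m) = p ^ (n - m) := by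
  have hp : 0 < p := (Fact.out : p.Prime).pos
  have step : ∀ m < n, Nat.card (levelSubgroup k y m) ≤
      p * Nat.card (levelSubgroup k y (m + 1)) := by
    intro m hm
    rw [← Subgroup.relIndex_bot_left (levelSubgroup k y m),
      ← Subgroup.relIndex_mul_relIndex _ _ _ bot_le (levelSubgroup_anti y m.le_succ),
      Subgroup.relIndex_bot_left, mul_comm p]
    exact Nat.mul_le_mul_left _ (relIndex_levelSubgroup_le (h m hm))
  have up : ∀ m ≤ n, p ^ n ≤ p ^ m * Nat.card (levelSubgroup k y m) := by
    intro m
    induction m with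
    | zero =>
      rw [levelSubgroup_zero, Subgroup.card_top, hcard, pow_zero, one_mul]
      exact fun _ => le_rfl
    | succ m ih =>
      intro hm
      refine (ih (by omega)).trans ?_
      rw [pow_succ, mul_assoc]
      exact Nat.mul_le_mul_left _ (step m (by omega))
  have down : ∀ d ≤ n, Nat.card (levelSubgroup k y (n - d)) ≤ p ^ d := by
    intro d
    induction d with
    | zero => simp [hbot]
    | succ d ih =>
      intro hd
      refine (step _ (by omega)).trans ?_
      rw [show n - (d + 1) + 1 = n - d by omega, pow_succ']
      exact Nat.mul_le_mul_left _ (ih (by omega))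
  refine le_antisymm ?_ ?_
  · simpa [Nat.sub_sub_self hm] using down (n - m) (Nat.sub_le _ _)
  · refine Nat.le_of_mul_le_mul_left ?_ (pow_pos hp m)
    rw [← pow_add, Nat.add_sub_cancel' hm]
    exact up m hm

variable {σ : Gal(K/k)}

theorem levelSubgroup_eq_zpowers (hcard : Nat.card Gal(K/k) = p ^ n)
    (hσ : Subgroup.zpowers σ = ⊤) (hbot : levelSubgroup k y n = ⊥)
    (h : ∀ m < n, ∀ g ∈ levelSubgroup k y m, (g (y m) - y m) ^ p = g (y m) - y m)
    {m : ℕ} (hm : m ≤ n) : levelSubgroup k y m = Subgroup.zpowers (σ ^ p ^ m) := by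
  have : IsCyclic Gal(K/k) := isCyclic_iff_exists_zpowers_eq_top.2 ⟨σ, hσ⟩
  have ho : orderOf σ = p ^ n := by rw [← Nat.card_zpowers, hσ, Subgroup.card_top, hcard]
  refine IsCyclic.subgroup_eq_of_card_eq ?_
  rw [card_levelSubgroup hcard hbot h hm, Nat.card_zpowers, orderOf_pow, ho,
    Nat.gcd_eq_right (pow_dvd_pow p hm), Nat.pow_div hm (Fact.out : p.Prime).pos]

/-- A subgroup between the levels `m` and `m + 1` that is not contained in the latter is the
level subgroup `m`. -/
theorem eq_levelSubgroup (hcard : Nat.card Gal(K/k) = p ^ n)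
    (hσ : Subgroup.zpowers σ = ⊤) (hbot : levelSubgroup k y n = ⊥)
    (h : ∀ m < n, ∀ g ∈ levelSubgroup k y m, (g (y m) - y m) ^ p = g (y m) - y m)
    {m : ℕ} (hm : m ≤ n) {S : Subgroup Gal(K/k)} (hS : S ≤ levelSubgroup k y m)
    (hS' : m < n → ¬ S ≤ levelSubgroup k y (m + 1)) : S = levelSubgroup k y m := by
  have : IsCyclic Gal(K/k) := isCyclic_iff_exists_zpowers_eq_top.2 ⟨σ, hσ⟩
  obtain ⟨a, ha, haS⟩ := (Nat.dvd_prime_pow (Fact.out : p.Prime)).1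
    (hcard ▸ Subgroup.card_subgroup_dvd_card S)
  have hSa : S = levelSubgroup k y (n - a) := by
    refine IsCyclic.subgroup_eq_of_card_eq ?_
    rw [haS, card_levelSubgroup hcard hbot h (Nat.sub_le _ _), Nat.sub_sub_self ha]
  refine le_antisymm hS ?_
  by_contra hlt
  have hlt' : m < n - a := by
    by_contra hle
    exact hlt (hSa ▸ levelSubgroup_anti y (not_lt.1 hle))
  exact hS' (by omega) (hSa ▸ levelSubgroup_anti y hlt')

end tower


open WithZero

/-! ### The infinite place of F(T) -/

section infinitePlace

variable {F : Type*} [Field F]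

theorem mem_inftyRing_iff {x : RatFunc F} :
    x ∈ inftyRing F ↔ x = 0 ∨ x.intDegree ≤ 0 := by
  classical
  rw [Valuation.mem_valuationSubring_iff, RatFunc.inftyValuation_apply]
  rcases eq_or_ne x 0 with rfl | hx
  · simp [RatFunc.InftyValuation.map_zero']
  · rw [RatFunc.inftyValuation_of_nonzero F hx, ← exp_zero, exp_le_exp]
    simp [hx]

theorem mem_primeInfty_iff {x : inftyRing F} :
    x ∈ primeInfty F ↔ (x : RatFunc F) = 0 ∨ (x : RatFunc F).intDegree < 0 := by
  classical
  rw [Valuation.mem_maximalIdeal_iff, RatFunc.inftyValuation_apply]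
  rcases eq_or_ne (x : RatFunc F) 0 with hx | hx
  · simp [hx, RatFunc.InftyValuation.map_zero']
  · rw [RatFunc.inftyValuation_of_nonzero F hx, ← exp_zero, exp_lt_exp]
    simp [hx]

theorem intDegree_div_algebraMap {a b : F[X]} (ha : a ≠ 0) (hb : b ≠ 0) :
    (algebraMap F[X] (RatFunc F) a / algebraMap F[X] (RatFunc F) b).intDegree =
      (a.natDegree : ℤ) - b.natDegree := by
  rw [RatFunc.intDegree_div (by simpa) (by simpa), RatFunc.intDegree_polynomial,
    RatFunc.intDegree_polynomial]

theorem eq_zero_or_intDegree_div_lt {a b : F[X]} (h : a.degree < b.degree) :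
    algebraMap F[X] (RatFunc F) a / algebraMap F[X] (RatFunc F) b = 0 ∨
      (algebraMap F[X] (RatFunc F) a / algebraMap F[X] (RatFunc F) b).intDegree < 0 := by
  rcases eq_or_ne a 0 with rfl | ha
  · simp
  · have hb : b ≠ 0 := by
      rintro rfl
      simp at h
    rw [intDegree_div_algebraMap ha hb]
    have := Polynomial.natDegree_lt_natDegree ha h
    right
    omega

variable (F) in
/-- The constants in the valuation ring of the infinite place. -/
def constHom : F →+* inftyRing F :=
  (algebraMap F (RatFunc F)).codRestrict (inftyRing F) fun c => by
    exact mem_inftyRing_iff.2 (Or.inr (RatFunc.intDegree_C c).le)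

theorem coe_constHom (c : F) :
    (constHom F c : RatFunc F) = algebraMap F[X] (RatFunc F) (Polynomial.C c) := by
  rw [RatFunc.algebraMap_C]
  rfl

theorem exists_sub_constHom_mem (x : inftyRing F) : ∃ c : F, x - constHom F c ∈ primeInfty F := by
  rcases x with ⟨x, hx⟩
  set a := x.num
  set b := x.denom
  have hb : b ≠ 0 := x.denom_ne_zero
  have hxab : x = algebraMap F[X] (RatFunc F) a / algebraMap F[X] (RatFunc F) b :=
    (RatFunc.num_div_denom x).symm
  have hle : a.natDegree ≤ b.natDegree := by
    rcases eq_or_ne a 0 with ha | ha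
    · simp [ha]
    · have hx0 : x ≠ 0 := by
        rw [hxab]
        exact div_ne_zero (by simpa) (by simpa)
      have := (mem_inftyRing_iff.1 hx).resolve_left hx0
      rw [hxab, intDegree_div_algebraMap ha hb] at this
      omega
  -- The residue at infinity is the quotient of the coefficients in degree `b.natDegree`, and the
  -- denominator is monic.
  set c := a.coeff b.natDegree
  refine ⟨c, mem_primeInfty_iff.2 ?_⟩
  have hlt : (a - Polynomial.C c * b).degree < b.degree := by
    rw [Polynomial.degree_eq_natDegree hb, Polynomial.degree_lt_iff_coeff_zero]
    intro m hm
    rw [Polynomial.coeff_sub, Polynomial.coeff_C_mul]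
    rcases hm.eq_or_lt with rfl | hm
    · have : b.coeff b.natDegree = 1 := (RatFunc.monic_denom x).coeff_natDegree
      rw [this, mul_one, sub_self]
    · rw [Polynomial.coeff_eq_zero_of_natDegree_lt (hle.trans_lt hm),
        Polynomial.coeff_eq_zero_of_natDegree_lt hm, mul_zero, sub_zero]
  have hsub : ((⟨x, hx⟩ - constHom F c : inftyRing F) : RatFunc F) =
      algebraMap F[X] (RatFunc F) (a - Polynomial.C c * b) / algebraMap F[X] (RatFunc F) b := by
    have hb' : algebraMap F[X] (RatFunc F) b ≠ 0 := by simpa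
    rw [map_sub, map_mul, sub_div, mul_div_cancel_right₀ _ hb', ← hxab, ← coe_constHom]
    rfl
  rw [hsub]
  exact eq_zero_or_intDegree_div_lt hlt

theorem primeInfty_eq_span : ∃ π : inftyRing F, (π : RatFunc F) = RatFunc.X⁻¹ ∧
    primeInfty F = Ideal.span {π} := by
  have hX : (RatFunc.X⁻¹ : RatFunc F) ∈ inftyRing F :=
    mem_inftyRing_iff.2 (Or.inr (by rw [RatFunc.intDegree_inv, RatFunc.intDegree_X]; omega))
  refine ⟨⟨_, hX⟩, rfl, le_antisymm (fun x hx => ?_) ?_⟩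
  · rw [Ideal.mem_span_singleton]
    have hm : (x : RatFunc F) * RatFunc.X ∈ inftyRing F := by
      rw [mem_inftyRing_iff]
      rcases mem_primeInfty_iff.1 hx with h | h
      · simp [h]
      · rcases eq_or_ne (x : RatFunc F) 0 with h0 | h0
        · simp [h0]
        · rw [RatFunc.intDegree_mul h0 RatFunc.X_ne_zero, RatFunc.intDegree_X]
          right
          omega
    refine ⟨⟨_, hm⟩, Subtype.ext ?_⟩
    change (x : RatFunc F) = RatFunc.X⁻¹ * ((x : RatFunc F) * RatFunc.X)
    field_simp [RatFunc.X_ne_zero]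
  · rw [Ideal.span_singleton_le_iff_mem, mem_primeInfty_iff]
    right
    change (RatFunc.X⁻¹ : RatFunc F).intDegree < 0
    rw [RatFunc.intDegree_inv, RatFunc.intDegree_X]
    omega

/-- 1/T is a uniformizer and f / T^(deg f) is a unit. -/
theorem valuation_eq_exp_natDegree (v : IsDedekindDomain.HeightOneSpectrum (inftyRing F))
    (hv : v.asIdeal = primeInfty F) {f : F[X]} (hf : f ≠ 0) :
    v.valuation (RatFunc F) (algebraMap F[X] (RatFunc F) f) = exp (f.natDegree : ℤ) := by
  obtain ⟨π, hπ, hspan⟩ := primeInfty_eq_span (F := F)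
  have hπ0 : π ≠ 0 := by
    rintro rfl
    exact inv_ne_zero RatFunc.X_ne_zero hπ.symm
  have hvX : v.valuation (RatFunc F) RatFunc.X = exp (1 : ℤ) := by
    have h := v.intValuation_singleton hπ0 (hv.trans hspan)
    rw [← v.valuation_of_algebraMap (K := RatFunc F)] at h
    change v.valuation (RatFunc F) (π : RatFunc F) = _ at h
    rw [hπ, map_inv₀] at h
    rw [← inv_inv (v.valuation (RatFunc F) RatFunc.X), h, ← exp_neg, neg_neg]
  set x := algebraMap F[X] (RatFunc F) f / RatFunc.X ^ f.natDegree with hx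
  have hf0 : algebraMap F[X] (RatFunc F) f ≠ 0 := by simpa
  have hXd : (RatFunc.X ^ f.natDegree : RatFunc F) ≠ 0 := pow_ne_zero _ RatFunc.X_ne_zero
  have hx0 : x ≠ 0 := div_ne_zero hf0 hXd
  have hdeg : x.intDegree = 0 := by
    have : (RatFunc.X ^ f.natDegree : RatFunc F) =
        algebraMap F[X] (RatFunc F) (Polynomial.X ^ f.natDegree) := by simp
    rw [hx, this, intDegree_div_algebraMap hf (pow_ne_zero _ Polynomial.X_ne_zero)]
    simp
  have hmem : x ∈ inftyRing F := mem_inftyRing_iff.2 (Or.inr hdeg.le)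
  have hval : v.valuation (RatFunc F) x = 1 := by
    have h : (⟨x, hmem⟩ : inftyRing F) ∉ v.asIdeal := by
      rw [hv, mem_primeInfty_iff]
      simp [hx0, hdeg]
    have := v.intValuation_eq_one_iff.2 h
    rwa [← v.valuation_of_algebraMap (K := RatFunc F)] at this
  have hfx : algebraMap F[X] (RatFunc F) f = x * RatFunc.X ^ f.natDegree := by
    rw [hx, div_mul_cancel₀ _ hXd]
  rw [hfx, map_mul, hval, map_pow, hvX, one_mul, ← exp_nsmul, nsmul_one]

end infinitePlace


/-! ### Splitting β into an integral part and a polynomial part -/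

section normalForm

open WittVector

variable {p : ℕ} [Fact p.Prime] {F : Type*} [Field F] {n r : ℕ} (N : NormalForm p F n r)

theorem truncate_out {R : Type*} [CommRing R] (x : TruncatedWittVector p n R) :
    WittVector.truncate n x.out = x :=
  TruncatedWittVector.truncateFun_out x

namespace NormalForm

/-- A lift of `δ i` to the valuation ring of the infinite place, with components in the maximal
ideal. -/
theorem exists_lift_delta (i : Fin r) : ∃ d : WittVector p (inftyRing F),
    map (algebraMap (inftyRing F) (RatFunc F)) d = (N.delta i).out ∧
    map (IsLocalRing.residue (inftyRing F)) d = 0 := by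
  have h : ∀ j : Fin n, ((N.delta i).coeff j = 0 ∨ ((N.delta i).coeff j).intDegree < 0) := by
    intro j
    rw [delta, TruncatedWittVector.coeff_mk]
    exact eq_zero_or_intDegree_div_lt (N.degree_lt i j)
  have h' : ∀ j, ((N.delta i).out.coeff j = 0 ∨ ((N.delta i).out.coeff j).intDegree < 0) := by
    intro j
    rcases lt_or_ge j n with hj | hj
    · exact (TruncatedWittVector.coeff_out (N.delta i) ⟨j, hj⟩).symm ▸ h ⟨j, hj⟩
    · exact Or.inl (by simp [TruncatedWittVector.out, hj.not_gt])
  refine ⟨WittVector.mk p fun j => ⟨(N.delta i).out.coeff j,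
    mem_inftyRing_iff.2 ((h' j).imp_right le_of_lt)⟩, ?_, ?_⟩
  · ext j
    rw [map_coeff, coeff_mk]
    rfl
  · ext j
    rw [map_coeff, coeff_mk, zero_coeff, IsLocalRing.residue_eq_zero_iff]
    exact mem_primeInfty_iff.2 (h' j)

/-- If the first `t` components of `μ` are constant, then the first `t` components of `β` are
integral at the infinite place, with the components of `μ` as residues; the remaining
components of `μ` only contribute a multiple of `V ^ t`. -/
theorem exists_integral_add_truncate_eq_beta {t : ℕ}
    (hconsts : ∀ j : Fin n, (j : ℕ) < t → ∃ c : F, N.f j = Polynomial.C c) :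
    ∃ (b : WittVector p (inftyRing F)) (z : WittVector p (RatFunc F)),
      WittVector.truncate n (map (algebraMap (inftyRing F) (RatFunc F)) b + z) = N.beta ∧
      (∀ i < t, z.coeff i = 0) ∧
      (∀ i : Fin n, (i : ℕ) = t → z.coeff i = algebraMap F[X] (RatFunc F) (N.f i)) ∧
      ∀ i : Fin n, (i : ℕ) < t → ∀ c : F, N.f i = Polynomial.C c →
        IsLocalRing.residue (inftyRing F) (b.coeff i) =
          IsLocalRing.residue (inftyRing F) (constHom F c) := by
  choose d hd hd0 using N.exists_lift_delta
  set m : WittVector p (inftyRing F) := WittVector.mk p fun j =>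
    if h : j < n then if j < t then constHom F ((N.f ⟨j, h⟩).coeff 0) else 0 else 0 with hm
  have hmt : map (algebraMap (inftyRing F) (RatFunc F)) m = init t N.mu.out := by
    ext j
    rw [map_coeff, hm, coeff_mk]
    rcases lt_or_ge j t with hjt | hjt
    · rw [coeff_init_of_lt hjt]
      split_ifs with hj
      · obtain ⟨c, hc⟩ := hconsts ⟨j, hj⟩ hjt
        have := TruncatedWittVector.coeff_out N.mu ⟨j, hj⟩
        rw [this, mu, TruncatedWittVector.coeff_mk, hc, Polynomial.coeff_C_zero, ← coe_constHom]
        rfl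
      · simp [TruncatedWittVector.out, hj]
    · rw [coeff_init_of_le hjt]
      simp [hjt.not_gt]
  refine ⟨∑ i, d i + m, tail t N.mu.out, ?_, fun i hi => coeff_tail_of_lt hi _, ?_, ?_⟩
  · rw [map_add (WittVector.map _), hmt, add_assoc, init_add_tail, map_add, map_sum, map_sum,
      truncate_out, beta]
    congr 1
    refine Finset.sum_congr rfl fun i _ => ?_
    rw [hd, truncate_out]
  · intro i hi
    rw [coeff_tail_of_le hi.ge, TruncatedWittVector.coeff_out, mu, TruncatedWittVector.coeff_mk]
  · intro i hi c hc
    -- Reduction modulo 𝔭_∞ is a ring homomorphism on Witt vectors, so the lifts of the δ_i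
    -- contribute nothing to any component.
    rw [← map_coeff, map_add, map_sum, Finset.sum_eq_zero fun i _ => hd0 i, zero_add,
      map_coeff, hm, coeff_mk, dif_pos i.2, if_pos hi, hc, Polynomial.coeff_C_zero]

end NormalForm

end normalForm

/-! ### The Witt vector equation in components -/

section equation

open WittVector

variable {p : ℕ} [Fact p.Prime] {n : ℕ} {k K : Type*} [Field k] [Field K] [Algebra k K]
  [CharP K p]

/-- The equation `y ^ p - y = β` in components. -/
theorem pow_sub_eq_carry {y : TruncatedWittVector p n K} {x : WittVector p k}
    (hy : powP y - y = mapCoeff K (WittVector.truncate n x)) {m : ℕ} (hm : m < n) :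
    y.out.coeff m ^ p - y.out.coeff m = carry m y.out (map (algebraMap k K) x) := by
  have h1 : WittVector.truncate n (frobenius y.out) = powP y := by
    ext i
    rw [coeff_truncate, coeff_frobenius_charP, TruncatedWittVector.coeff_out, powP,
      TruncatedWittVector.coeff_mk]
  have h2 : WittVector.truncate n (map (algebraMap k K) x) =
      mapCoeff K (WittVector.truncate n x) := by
    ext i
    rw [coeff_truncate, map_coeff, mapCoeff, TruncatedWittVector.coeff_mk, coeff_truncate]
  have h : WittVector.truncate n (frobenius y.out) =
      WittVector.truncate n (y.out + map (algebraMap k K) x) := by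
    rw [map_add, truncate_out, h1, h2, ← hy, add_sub_cancel]
  have := truncate_eq_iff.1 h m hm
  rw [coeff_frobenius_charP, coeff_add_eq_carry] at this
  rw [this, add_sub_cancel_right]

/-- The carry involves only components of `y` fixed by `g` and elements of `k`, so y_m and g(y_m)
solve the same Artin-Schreier equation. -/
theorem pow_sub_eq_self_of_mem_levelSubgroup {y : WittVector p K} {x : WittVector p k} {m : ℕ}
    (hy : y.coeff m ^ p - y.coeff m = carry m y (map (algebraMap k K) x))
    {g : Gal(K/k)} (hg : g ∈ levelSubgroup k y.coeff m) :
    (g (y.coeff m) - y.coeff m) ^ p = g (y.coeff m) - y.coeff m := by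
  have hc : g (carry m y (map (algebraMap k K) x)) = carry m y (map (algebraMap k K) x) := by
    have := map_carry (g : K →+* K) m y (map (algebraMap k K) x)
    rw [RingHom.coe_coe] at this
    rw [this]
    refine carry_congr (fun i hi => ?_) fun i _ => ?_
    · rw [map_coeff]
      exact hg i hi
    · rw [map_coeff, map_coeff]
      exact g.commutes _
  rw [← hy, map_sub, map_pow] at hc
  rw [sub_pow_char]
  linear_combination hc

omit [Fact p.Prime] [CharP K p] in
theorem levelSubgroup_eq_bot {y : TruncatedWittVector p n K}
    (hK : IntermediateField.adjoin k (Set.range fun j => y.coeff j) = ⊤) :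
    levelSubgroup k y.out.coeff n = ⊥ := by
  refine eq_bot_iff.2 fun g hg => ?_
  have hle : IntermediateField.adjoin k (Set.range fun j => y.coeff j) ≤
      IntermediateField.fixedField (Subgroup.zpowers g) := by
    rw [IntermediateField.adjoin_le_iff]
    rintro _ ⟨j, rfl⟩
    have hj : g (y.coeff j) = y.coeff j := by
      have := hg j j.2
      rwa [TruncatedWittVector.coeff_out] at this
    rw [SetLike.mem_coe, IntermediateField.mem_fixedField_iff]
    intro h hh
    have hz : Subgroup.zpowers g ≤ MulAction.stabilizer Gal(K/k) (y.coeff j) :=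
      Subgroup.zpowers_le.2 hj
    exact hz hh
  rw [hK] at hle
  rw [Subgroup.mem_bot]
  ext x
  exact (IntermediateField.mem_fixedField_iff _ _).1 (hle (IntermediateField.mem_top (x := x))) g
    (Subgroup.mem_zpowers g)

end equation

/-! ### Integrality of the first components -/

section integrality

open WittVector

variable {p : ℕ} [Fact p.Prime] {A B K : Type*} [CommRing A] [CommRing B] [Field K]
  [Algebra A B] [Algebra A K] [Algebra B K] [IsScalarTower A B K] [IsIntegralClosure B A K]

/-- The components of a solution of `y ^ p - y = b` are integral if those of `b` are. -/
theorem exists_integral_lift {t : ℕ} {y : WittVector p K} {b : WittVector p A}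
    (hy : ∀ m < t, y.coeff m ^ p - y.coeff m = carry m y (map (algebraMap A K) b)) :
    ∃ w : WittVector p B, ∀ j < t, algebraMap B K (w.coeff j) = y.coeff j := by
  induction t with
  | zero => exact ⟨0, fun j hj => absurd hj (Nat.not_lt_zero j)⟩
  | succ t ih =>
    obtain ⟨w, hw⟩ := ih fun m hm => hy m (hm.trans t.lt_succ_self)
    set c : B := carry t w (map (algebraMap A B) b)
    have hc : algebraMap B K c = y.coeff t ^ p - y.coeff t := by
      rw [hy t t.lt_succ_self, map_carry]
      refine carry_congr (fun i hi => ?_) fun i _ => ?_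
      · rw [map_coeff, hw i hi]
      · simp only [map_coeff, ← IsScalarTower.algebraMap_apply]
    have hp : 1 < p := (Fact.out : p.Prime).one_lt
    -- y_t is a root of the monic polynomial X^p - X - c over `B`.
    have hint : IsIntegral B (y.coeff t) := by
      refine ⟨Polynomial.X ^ p - (Polynomial.X + Polynomial.C c), ?_, ?_⟩
      · refine Polynomial.monic_X_pow_sub ?_
        refine (Polynomial.degree_add_le _ _).trans_lt (max_lt ?_ ?_)
        · exact Polynomial.degree_X_le.trans_lt (by exact_mod_cast hp)
        · exact Polynomial.degree_C_le.trans_lt (by exact_mod_cast zero_lt_one.trans hp)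
      · rw [← Polynomial.aeval_def]
        simp [hc]
    have : Algebra.IsIntegral A B := IsIntegralClosure.isIntegral_algebra A K
    obtain ⟨x, hx⟩ := (IsIntegralClosure.isIntegral_iff (A := B)).1
      (isIntegral_trans (R := A) _ hint)
    refine ⟨WittVector.mk p fun j => if j < t then w.coeff j else x, fun j hj => ?_⟩
    rw [coeff_mk]
    split_ifs with h
    · exact hw j h
    · rw [hx, show j = t by omega]

omit [IsIntegralClosure B A K] in
theorem carry_eq_algebraMap {t m : ℕ} {y : WittVector p K} (b : WittVector p A)
    {w : WittVector p B} (hw : ∀ j < t, algebraMap B K (w.coeff j) = y.coeff j) (hm : m ≤ t) :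
    carry m y (map (algebraMap A K) b) = algebraMap B K (carry m w (map (algebraMap A B) b)) := by
  rw [map_carry]
  refine carry_congr (fun i hi => ?_) fun i _ => ?_
  · rw [map_coeff, hw i (hi.trans_le hm)]
  · simp only [map_coeff, ← IsScalarTower.algebraMap_apply]

end integrality

end WittExt

/-! ### Fixed residues and unramified subextensions -/

namespace Ideal

section residue

attribute [local instance] Ideal.Quotient.field

/-- An element fixed by the decomposition group is congruent to an element of the base ring. -/
theorem exists_sub_algebraMap_mem_of_smul_eq {A B : Type*} [CommRing A] [CommRing B] [Algebra A B]
    [Module.Finite A B] (G : Type*) [Group G] [Finite G] [MulSemiringAction G B]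
    [IsGaloisGroup G A B] (q : Ideal A) [q.IsMaximal] [Finite (A ⧸ q)] (P : Ideal B) [P.IsMaximal]
    [P.LiesOver q] {x : B} (hx : ∀ g ∈ MulAction.stabilizer G P, g • x = x) :
    ∃ a : A, x - algebraMap A B a ∈ P := by
  have : Module.Finite (A ⧸ q) (B ⧸ P) := Module.Finite.of_restrictScalars_finite A _ _
  have : Finite (B ⧸ P) := Module.finite_of_finite (A ⧸ q)
  -- The decomposition group surjects onto the Galois group of the residue extension, which is
  -- Galois because the residue fields are finite.
  have hfix : ∀ τ : Gal((B ⧸ P)/(A ⧸ q)), τ (Ideal.Quotient.mk P x) = Ideal.Quotient.mk P x := by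
    intro τ
    obtain ⟨g, rfl⟩ := Ideal.Quotient.stabilizerHom_surjective G q P τ
    rw [Ideal.Quotient.stabilizerHom_apply]
    exact congr_arg (Ideal.Quotient.mk P) (hx g.1 g.2)
  obtain ⟨a, ha⟩ := IntermediateField.mem_bot.1 ((IsGalois.mem_bot_iff_fixed _).2 hfix)
  obtain ⟨a, rfl⟩ := Ideal.Quotient.mk_surjective a
  refine ⟨a, ?_⟩
  rw [Ideal.Quotient.algebraMap_mk_of_liesOver] at ha
  exact Ideal.Quotient.eq.1 ha.symm

end residue

section inertia

/-- The ramification index of a prime below `P` whose Galois group contains the inertia group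
of `P` is `1`. -/
theorem ramificationIdx_eq_one_of_inertia_le {A B C : Type*} [CommRing A] [CommRing B] [CommRing C]
    [IsDomain A] [IsDomain B] [IsDomain C] [Algebra A B] [Algebra A C] [Algebra C B]
    [IsScalarTower A C B] [Module.Finite A B] [Module.Finite A C] [Module.Finite C B]
    [Module.Flat A B] [Module.Flat C B] {G : Type*} [Group G] [Finite G] [MulSemiringAction G B]
    [IsGaloisGroup G A B] {H : Subgroup G} [IsGaloisGroup H C B] (q : Ideal A) [q.IsMaximal]
    [Finite (A ⧸ q)] (Q : Ideal C) [Q.IsMaximal] [Q.LiesOver q] (P : Ideal B) [P.IsPrime]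
    [P.LiesOver Q] (h : P.inertia G ≤ H) : Q.ramificationIdx A = 1 := by
  have : P.LiesOver q := .trans P Q q
  let := Ideal.Quotient.field q
  let := Ideal.Quotient.field Q
  have : Module.Finite (A ⧸ q) (C ⧸ Q) := Module.Finite.of_restrictScalars_finite A _ _
  have : Finite (C ⧸ Q) := Module.finite_of_finite (A ⧸ q)
  have h1 : Nat.card (P.inertia G) = P.ramificationIdx A := by
    rw [card_inertia_eq_ramificationIdxIn q P, ramificationIdxIn_eq_ramificationIdx q P G]
  have h2 : Nat.card (P.inertia H) = P.ramificationIdx C := by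
    rw [card_inertia_eq_ramificationIdxIn Q P, ramificationIdxIn_eq_ramificationIdx Q P H]
  -- As `H` contains the inertia group, inertia has the same order over `A` and over `C`;
  -- multiplicativity of e leaves 1 for `Q`.
  have h3 : Nat.card (P.inertia H) = Nat.card (P.inertia G) :=
    Nat.card_congr (Subgroup.subgroupOfEquivOfLe h).toEquiv
  have h4 := ramificationIdx_tower (R := A) Q P
  rw [← h1, ← h2, h3] at h4
  exact (Nat.eq_of_mul_eq_mul_right Nat.card_pos ((one_mul _).trans h4)).symm

end inertia

end Ideal

/-! ### Detecting levels modulo a prime -/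

namespace WittExt

section localLevels

open WittVector

variable {p : ℕ} [Fact p.Prime] {A B k K : Type*} [CommRing A] [CommRing B] [Field k] [Field K]
  [Algebra A B] [Algebra k K] [Algebra B K] [FaithfulSMul B K] [MulSemiringAction Gal(K/k) B]
  [SMulDistribClass Gal(K/k) B K]

/-- By induction, d = g w_t - w_t satisfies d^p = d. If d ≠ 0 then d^(p-1) = 1, so d is a unit and
cannot lie in `P`. -/
theorem mem_levelSubgroup_of_smul_sub_mem {t : ℕ} {y : ℕ → K} {w : ℕ → B}
    (hw : ∀ j < t, algebraMap B K (w j) = y j)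
    (hy : ∀ m < t, ∀ g ∈ levelSubgroup k y m, (g (y m) - y m) ^ p = g (y m) - y m)
    (P : Ideal B) [P.IsPrime] {g : Gal(K/k)} (hg : ∀ j < t, g • w j - w j ∈ P) :
    g ∈ levelSubgroup k y t := by
  have hinj := FaithfulSMul.algebraMap_injective B K
  have : IsDomain B := hinj.isDomain _
  induction t with
  | zero => exact levelSubgroup_zero (k := k) y ▸ Subgroup.mem_top g
  | succ t ih =>
    have hgt := ih (fun j hj => hw j (hj.trans t.lt_succ_self))
      (fun m hm => hy m (hm.trans t.lt_succ_self)) fun j hj => hg j (hj.trans t.lt_succ_self)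
    refine mem_levelSubgroup_succ.2 ⟨hgt, ?_⟩
    have hd : algebraMap B K (g • w t - w t) = g (y t) - y t := by
      rw [map_sub, algebraMap.smul', hw t t.lt_succ_self]
      rfl
    have hpow := hy t t.lt_succ_self g hgt
    rw [← hd, ← map_pow] at hpow
    have hpow' := hinj hpow
    by_contra hne
    have hd0 : g • w t - w t ≠ 0 := by
      intro h0
      rw [h0, map_zero] at hd
      exact hne (sub_eq_zero.1 hd.symm)
    have hp : p - 1 ≠ 0 := (Nat.sub_pos_of_lt (Fact.out : p.Prime).one_lt).ne'
    have hone : (g • w t - w t) ^ (p - 1) = 1 := by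
      refine mul_right_cancel₀ hd0 ?_
      rw [← pow_succ, Nat.sub_add_cancel (Fact.out : p.Prime).one_lt.le, hpow', one_mul]
    have := P.pow_mem_of_mem (hg t t.lt_succ_self) (p - 1) (Nat.pos_of_ne_zero hp)
    rw [hone] at this
    exact Ideal.IsPrime.ne_top' ((Ideal.eq_top_iff_one P).2 this)

/-- If the first `s` components of `b` vanish modulo `P`, then a solution of `w ^ p - w = b`
satisfies an Artin-Schreier equation modulo `P` in component `s`. -/
theorem pow_sub_sub_mem {s : ℕ} {w : WittVector p B} {b : WittVector p A} {P : Ideal B}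
    (hw : w.coeff s ^ p - w.coeff s = carry s w (map (algebraMap A B) b))
    (hb : ∀ i < s, algebraMap A B (b.coeff i) ∈ P) :
    w.coeff s ^ p - w.coeff s - algebraMap A B (b.coeff s) ∈ P := by
  -- Over the quotient by `P` the components of `b` below `s` vanish, so the carry is just b_s,
  -- whatever `w` is.
  rw [hw, ← Ideal.Quotient.eq, map_carry, carry_of_forall_lt_eq_zero, map_coeff, map_coeff]
  intro i hi
  rw [map_coeff, map_coeff]
  exact Ideal.Quotient.eq_zero_iff_mem.2 (hb i hi)

end localLevels

/-- The residue of `x` lies in 𝔽_p, so `x` is congruent to an integer, which `g` fixes. -/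
theorem smul_sub_mem_of_mem_stabilizer {p : ℕ} [Fact p.Prime] {B : Type*} [CommRing B] [CharP B p]
    {G : Type*} [Group G] [MulSemiringAction G B] {x : B} {P : Ideal B} [P.IsMaximal]
    (hx : x ^ p - x ∈ P) {g : G} (hg : g ∈ MulAction.stabilizer G P) :
    g • x - x ∈ P := by
  let := Ideal.Quotient.field P
  have : CharP (B ⧸ P) p := by
    rw [CharP.charP_iff_prime_eq_zero (Fact.out : p.Prime), ← map_natCast (Ideal.Quotient.mk P),
      CharP.cast_eq_zero, map_zero]
  obtain ⟨a, ha⟩ := exists_intCast_eq_of_pow_eq_self (p := p) (x := Ideal.Quotient.mk P x)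
    (by rw [← map_pow]; exact Ideal.Quotient.eq.2 hx)
  have hxa : x - a ∈ P := by
    rw [← Ideal.Quotient.eq, ← ha, map_intCast]
  have hga : g • x - a ∈ P := by
    have h := Ideal.smul_mem_pointwise_smul g _ P hxa
    rw [MulAction.mem_stabilizer_iff.1 hg, smul_sub] at h
    have hz : g • (a : B) = a := map_intCast (MulSemiringAction.toRingHom G B g) a
    rwa [hz] at h
  simpa using P.sub_mem hga hxa

/-! ### Pole orders and ramification at infinity -/

section valuation

open WithZero IsDedekindDomain

/-- At an unramified place above infinity, an Artin-Schreier equation whose right-hand side is the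
sum of an integral element and a nonconstant polynomial of degree prime to `p` has no solution. -/
theorem dvd_natDegree_of_pow_sub_eq {p : ℕ} (hp : 1 < p) {F : Type*} [Field F] {C L : Type*}
    [Field L] [Algebra (RatFunc F) L] [CommRing C] [IsDedekindDomain C] [Algebra (inftyRing F) C]
    [Module.IsTorsionFree (inftyRing F) C] [Algebra (inftyRing F) L]
    [IsScalarTower (inftyRing F) (RatFunc F) L] [Algebra C L] [IsFractionRing C L]
    [IsScalarTower (inftyRing F) C L] (Q : Ideal C) [Q.IsPrime] [Q.LiesOver (primeInfty F)]
    (hQ : Q.ramificationIdx (inftyRing F) = 1) {x : L} {u : C} {f : F[X]}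
    (hf : 0 < f.natDegree)
    (hx : x ^ p - x = algebraMap C L u +
      algebraMap (RatFunc F) L (algebraMap F[X] (RatFunc F) f)) : p ∣ f.natDegree := by
  have hbot : primeInfty F ≠ ⊥ := IsDiscreteValuationRing.not_a_field _
  let v : HeightOneSpectrum (inftyRing F) := ⟨primeInfty F, inferInstance, hbot⟩
  let w : HeightOneSpectrum C := ⟨Q, inferInstance, Ideal.ne_bot_of_liesOver_of_ne_bot hbot Q⟩
  have : w.asIdeal.LiesOver v.asIdeal := ‹Q.LiesOver (primeInfty F)›
  have hwf : w.valuation L (algebraMap (RatFunc F) L (algebraMap F[X] (RatFunc F) f)) =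
      exp (f.natDegree : ℤ) := by
    have hf0 : f ≠ 0 := by
      rintro rfl
      simp at hf
    rw [← HeightOneSpectrum.valuation_liesOver L v w,
      Ideal.ramificationIdx'_eq_ramificationIdx _ _ hbot, hQ, pow_one,
      valuation_eq_exp_natDegree v rfl hf0]
  have hu : w.valuation L (algebraMap C L u) ≤ 1 := w.valuation_le_one u
  have hlt : 1 < exp (f.natDegree : ℤ) := by
    rw [← exp_zero, exp_lt_exp]
    exact_mod_cast hf
  have hright : w.valuation L (x ^ p - x) = exp (f.natDegree : ℤ) := by
    rw [hx, Valuation.map_add_eq_of_lt_right _ (hwf ▸ hu.trans_lt hlt), hwf]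
  -- The right-hand side has a pole of order deg f, so `x` has a pole and x^p dominates x; hence deg
  -- f is p times the pole order of `x`.
  have hx1 : 1 < w.valuation L x := by
    by_contra hle
    rw [not_lt] at hle
    have : w.valuation L (x ^ p - x) ≤ 1 :=
      (Valuation.map_sub _ _ _).trans (max_le (by rw [map_pow]; exact pow_le_one' hle p) hle)
    rw [hright] at this
    exact hlt.not_ge this
  have hxp : w.valuation L x < w.valuation L (x ^ p) := by
    rw [map_pow]
    exact lt_self_pow₀ hx1 hp
  rw [Valuation.map_sub_eq_of_lt_left _ hxp, map_pow] at hright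
  have hx0 : w.valuation L x ≠ 0 := (zero_lt_one.trans hx1).ne'
  rw [← exp_log hx0, ← exp_nsmul, exp_inj] at hright
  rw [← Int.natCast_dvd_natCast]
  exact ⟨_, by rw [← hright, nsmul_eq_mul]⟩

end valuation


/-! ### Integral closures in K and in fixed fields -/

section inftyIntegers

variable (F : Type*) [Field F] (K : Type*) [Field K] [Algebra (RatFunc F) K]
  [FiniteDimensional (RatFunc F) K] [IsGalois (RatFunc F) K]

instance isDedekindDomain_inftyIntegers : IsDedekindDomain (inftyIntegers F K) :=
  integralClosure.isDedekindDomain (inftyRing F) (RatFunc F) K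

instance finite_inftyIntegers : Module.Finite (inftyRing F) (inftyIntegers F K) :=
  IsIntegralClosure.finite (inftyRing F) (RatFunc F) K (inftyIntegers F K)

instance isFractionRing_inftyIntegers : IsFractionRing (inftyIntegers F K) K :=
  integralClosure.isFractionRing_of_finite_extension (RatFunc F) K

instance isGaloisGroup_inftyIntegers :
    IsGaloisGroup Gal(K/RatFunc F) (inftyRing F) (inftyIntegers F K) :=
  IsGaloisGroup.of_isFractionRing _ _ _ (RatFunc F) K

instance finite_residue_primeInfty [Finite F] : Finite (inftyRing F ⧸ primeInfty F) := by
  refine Finite.of_surjective (fun c : F => Ideal.Quotient.mk (primeInfty F) (constHom F c)) ?_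
  intro x
  obtain ⟨x, rfl⟩ := Ideal.Quotient.mk_surjective x
  obtain ⟨c, hc⟩ := exists_sub_constHom_mem x
  exact ⟨c, (Ideal.Quotient.eq.2 hc).symm⟩

end inftyIntegers

variable {F : Type*} [Field F] {K : Type*} [Field K] [Algebra (RatFunc F) K]
  [FiniteDimensional (RatFunc F) K] [IsGalois (RatFunc F) K]

/-- The integral closure of the valuation ring of the infinite place in the fixed field of `H`. -/
def FixedInftyIntegers (H : Subgroup Gal(K/RatFunc F)) : Type _ :=
  integralClosure (inftyRing F) (IntermediateField.fixedField H)

namespace FixedInftyIntegers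

variable (H : Subgroup Gal(K/RatFunc F))

instance : CommRing (FixedInftyIntegers H) :=
  inferInstanceAs (CommRing (integralClosure (inftyRing F) (IntermediateField.fixedField H)))

instance : Algebra (inftyRing F) (FixedInftyIntegers H) :=
  inferInstanceAs (Algebra (inftyRing F)
    (integralClosure (inftyRing F) (IntermediateField.fixedField H)))

instance : Algebra (FixedInftyIntegers H) (IntermediateField.fixedField H) :=
  inferInstanceAs (Algebra (integralClosure (inftyRing F) (IntermediateField.fixedField H))
    (IntermediateField.fixedField H))

instance : IsScalarTower (inftyRing F) (FixedInftyIntegers H) (IntermediateField.fixedField H) :=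
  inferInstanceAs (IsScalarTower (inftyRing F)
    (integralClosure (inftyRing F) (IntermediateField.fixedField H))
    (IntermediateField.fixedField H))

instance : IsIntegralClosure (FixedInftyIntegers H) (inftyRing F)
    (IntermediateField.fixedField H) :=
  inferInstanceAs (IsIntegralClosure
    (integralClosure (inftyRing F) (IntermediateField.fixedField H)) (inftyRing F)
    (IntermediateField.fixedField H))

instance : IsDedekindDomain (FixedInftyIntegers H) :=
  integralClosure.isDedekindDomain (inftyRing F) (RatFunc F) (IntermediateField.fixedField H)

instance : Module.Finite (inftyRing F) (FixedInftyIntegers H) :=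
  IsIntegralClosure.finite (inftyRing F) (RatFunc F) (IntermediateField.fixedField H)
    (FixedInftyIntegers H)

instance : IsFractionRing (FixedInftyIntegers H) (IntermediateField.fixedField H) :=
  integralClosure.isFractionRing_of_finite_extension (RatFunc F) (IntermediateField.fixedField H)

/-- The inclusion into the integral closure in `K`. -/
def inclusion : FixedInftyIntegers H →ₐ[inftyRing F] inftyIntegers F K :=
  AlgHom.mapIntegralClosure (R := inftyRing F)
    (IsScalarTower.toAlgHom (inftyRing F) (IntermediateField.fixedField H) K)

instance : Algebra (FixedInftyIntegers H) (inftyIntegers F K) :=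
  (inclusion H).toRingHom.toAlgebra

instance : Algebra (FixedInftyIntegers H) K :=
  ((algebraMap (IntermediateField.fixedField H) K).comp
    (algebraMap (FixedInftyIntegers H) (IntermediateField.fixedField H))).toAlgebra

instance : IsScalarTower (FixedInftyIntegers H) (IntermediateField.fixedField H) K :=
  .of_algebraMap_eq fun _ => rfl

instance : IsScalarTower (inftyRing F) (FixedInftyIntegers H) (inftyIntegers F K) :=
  .of_algebraMap_eq fun a => ((inclusion H).commutes a).symm

instance : IsScalarTower (FixedInftyIntegers H) (inftyIntegers F K) K :=
  .of_algebraMap_eq fun _ => rfl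

instance : Module.Finite (FixedInftyIntegers H) (inftyIntegers F K) :=
  Module.Finite.right (inftyRing F) _ _

instance : IsGaloisGroup H (FixedInftyIntegers H) (inftyIntegers F K) :=
  have : IsGaloisGroup H (IntermediateField.fixedField H) K :=
    IsGaloisGroup.subgroup Gal(K/RatFunc F) (RatFunc F) K H
  IsGaloisGroup.of_isFractionRing _ _ _ (IntermediateField.fixedField H) K

instance : FaithfulSMul (FixedInftyIntegers H) (inftyIntegers F K) := by
  rw [faithfulSMul_iff_algebraMap_injective]
  intro a b hab
  have h : algebraMap (FixedInftyIntegers H) K a = algebraMap (FixedInftyIntegers H) K b := by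
    rw [IsScalarTower.algebraMap_apply _ (inftyIntegers F K) K, hab,
      ← IsScalarTower.algebraMap_apply]
  exact IsFractionRing.injective (FixedInftyIntegers H) (IntermediateField.fixedField H)
    ((algebraMap (IntermediateField.fixedField H) K).injective h)

instance : FaithfulSMul (inftyRing F) (FixedInftyIntegers H) :=
  have : FaithfulSMul (inftyRing F) (IntermediateField.fixedField H) := by
    rw [faithfulSMul_iff_algebraMap_injective, IsScalarTower.algebraMap_eq _ (RatFunc F)]
    exact (algebraMap (RatFunc F) _).injective.comp Subtype.val_injective
  FaithfulSMul.tower_bot _ _ (IntermediateField.fixedField H)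

end FixedInftyIntegers

/-- If the inertia group fixes a root `x` of an Artin-Schreier equation whose right-hand side is the
sum of an integral element and a nonconstant polynomial `f`, then `p` divides the degree of `f`. -/
theorem dvd_natDegree_of_inertia_le [Finite F] {p : ℕ} (hp : 1 < p) (P : Ideal (inftyIntegers F K))
    [P.IsPrime] [P.LiesOver (primeInfty F)] {H : Subgroup Gal(K/RatFunc F)}
    (hH : P.inertia Gal(K/RatFunc F) ≤ H) {x : K} (hxH : ∀ g ∈ H, g x = x)
    {u : inftyIntegers F K} {f : F[X]} (hf : 0 < f.natDegree)
    (hx : x ^ p - x = algebraMap (inftyIntegers F K) K u +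
      algebraMap (RatFunc F) K (algebraMap F[X] (RatFunc F) f)) : p ∣ f.natDegree := by
  let L := IntermediateField.fixedField H
  let C := FixedInftyIntegers H
  let Q := P.under C
  have : Q.LiesOver (primeInfty F) := Ideal.LiesOver.tower_bot P Q _
  have : Q.IsMaximal := Ideal.IsMaximal.of_liesOver_isMaximal Q (primeInfty F)
  have hQ : Q.ramificationIdx (inftyRing F) = 1 :=
    Ideal.ramificationIdx_eq_one_of_inertia_le (primeInfty F) Q P hH
  let x' : L := ⟨x, (IntermediateField.mem_fixedField_iff _ _).2 hxH⟩
  let f' : L := algebraMap (RatFunc F) L (algebraMap F[X] (RatFunc F) f)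
  have hxu : algebraMap L K (x' ^ p - x' - f') = algebraMap (inftyIntegers F K) K u :=
    sub_eq_iff_eq_add.2 hx
  -- The integral term `u` equals x^p - x - f, so it already belongs to the fixed field and descends
  -- to `C`.
  have hint : IsIntegral (inftyRing F) (x' ^ p - x' - f') := by
    rw [← isIntegral_algebraMap_iff (algebraMap L K).injective, hxu]
    exact u.2
  obtain ⟨u', hu'⟩ := (IsIntegralClosure.isIntegral_iff (A := C)).1 hint
  exact dvd_natDegree_of_pow_sub_eq hp Q hQ hf (sub_eq_iff_eq_add.1 hu'.symm)


open WittVector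

/-! ### Bounds for the inertia and decomposition groups -/

section groups

variable {p : ℕ} [Fact p.Prime] {F : Type*} [Field F] {K : Type*} [Field K] [CharP K p]
  [Algebra (RatFunc F) K] [FiniteDimensional (RatFunc F) K] [IsGalois (RatFunc F) K]
  {t : ℕ} {y : WittVector p K} {b : WittVector p (inftyRing F)}
  {w : WittVector p (inftyIntegers F K)}

instance charP_inftyIntegers : CharP (inftyIntegers F K) p :=
  (algebraMap (inftyIntegers F K) K).charP (FaithfulSMul.algebraMap_injective _ _) p

omit [FiniteDimensional (RatFunc F) K] [IsGalois (RatFunc F) K] [CharP K p] in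
theorem lift_pow_sub_eq_carry
    (hy : ∀ m < t, y.coeff m ^ p - y.coeff m = carry m y (map (algebraMap (inftyRing F) K) b))
    (hw : ∀ j < t, algebraMap (inftyIntegers F K) K (w.coeff j) = y.coeff j) {m : ℕ} (hm : m < t) :
    w.coeff m ^ p - w.coeff m =
      carry m w (map (algebraMap (inftyRing F) (inftyIntegers F K)) b) := by
  apply FaithfulSMul.algebraMap_injective (inftyIntegers F K) K
  rw [← carry_eq_algebraMap b hw hm.le, ← hy m hm, map_sub, map_pow, hw m hm]

variable (P : Ideal (inftyIntegers F K)) [P.IsPrime]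

omit [IsGalois (RatFunc F) K] [FiniteDimensional (RatFunc F) K] [CharP K p] in
theorem inertia_le_levelSubgroup
    (hfix : ∀ m < t, ∀ g ∈ levelSubgroup (RatFunc F) y.coeff m,
      (g (y.coeff m) - y.coeff m) ^ p = g (y.coeff m) - y.coeff m)
    (hw : ∀ j < t, algebraMap (inftyIntegers F K) K (w.coeff j) = y.coeff j) :
    P.inertia Gal(K/RatFunc F) ≤ levelSubgroup (RatFunc F) y.coeff t := fun _ hg =>
  mem_levelSubgroup_of_smul_sub_mem hw hfix P fun _ _ => hg _

variable [P.LiesOver (primeInfty F)]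

omit [IsGalois (RatFunc F) K] [CharP K p] [FiniteDimensional (RatFunc F) K] [P.IsPrime] in
theorem algebraMap_mem_of_mem_primeInfty {a : inftyRing F} (ha : a ∈ primeInfty F) :
    algebraMap (inftyRing F) (inftyIntegers F K) a ∈ P :=
  (P.mem_of_liesOver (primeInfty F) a).1 ha

instance isMaximal_of_liesOver_primeInfty : P.IsMaximal :=
  Ideal.IsMaximal.of_liesOver_isMaximal P (primeInfty F)

-- Used with `s` in the role of `t`: where `b` vanishes modulo 𝔭_∞, each w_j satisfies w_j^p ≡ w_j
-- modulo `P`.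
omit [IsGalois (RatFunc F) K] [FiniteDimensional (RatFunc F) K] in
theorem stabilizer_le_levelSubgroup
    (hfix : ∀ m < t, ∀ g ∈ levelSubgroup (RatFunc F) y.coeff m,
      (g (y.coeff m) - y.coeff m) ^ p = g (y.coeff m) - y.coeff m)
    (hy : ∀ m < t, y.coeff m ^ p - y.coeff m = carry m y (map (algebraMap (inftyRing F) K) b))
    (hw : ∀ j < t, algebraMap (inftyIntegers F K) K (w.coeff j) = y.coeff j)
    (hb : ∀ i < t, b.coeff i ∈ primeInfty F) :
    MulAction.stabilizer Gal(K/RatFunc F) P ≤ levelSubgroup (RatFunc F) y.coeff t := by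
  intro g hg
  have hbP : ∀ i < t, algebraMap (inftyRing F) (inftyIntegers F K) (b.coeff i) ∈ P :=
    fun i hi => algebraMap_mem_of_mem_primeInfty P (hb i hi)
  refine mem_levelSubgroup_of_smul_sub_mem hw hfix P fun j hj => ?_
  refine smul_sub_mem_of_mem_stabilizer (p := p) ?_ hg
  have := P.add_mem (pow_sub_sub_mem (lift_pow_sub_eq_carry hy hw hj)
    fun i hi => hbP i (hi.trans hj)) (hbP j hj)
  rwa [sub_add_cancel] at this

/-- Otherwise the decomposition group fixes w_s, whose residue is then a constant d in `F`; reducing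
the equation gives d^p - d = c. -/
theorem not_stabilizer_le_levelSubgroup [Finite F] [CharP F p]
    (hy : ∀ m < t, y.coeff m ^ p - y.coeff m = carry m y (map (algebraMap (inftyRing F) K) b))
    (hw : ∀ j < t, algebraMap (inftyIntegers F K) K (w.coeff j) = y.coeff j) {s : ℕ} (hst : s < t)
    (hb : ∀ i < s, b.coeff i ∈ primeInfty F) {c : F} (hc : c ∉ artinSchreierImage p F)
    (hbc : b.coeff s - constHom F c ∈ primeInfty F) :
    ¬ MulAction.stabilizer Gal(K/RatFunc F) P ≤ levelSubgroup (RatFunc F) y.coeff (s + 1) := by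
  intro hle
  have hfixed : ∀ g ∈ MulAction.stabilizer Gal(K/RatFunc F) P, g • w.coeff s = w.coeff s := by
    intro g hg
    apply FaithfulSMul.algebraMap_injective (inftyIntegers F K) K
    rw [algebraMap.smul', hw s hst]
    exact (mem_levelSubgroup_succ.1 (hle hg)).2
  obtain ⟨a, ha⟩ := Ideal.exists_sub_algebraMap_mem_of_smul_eq Gal(K/RatFunc F) (primeInfty F) P
    hfixed
  obtain ⟨d, hd⟩ := exists_sub_constHom_mem a
  have hwd : w.coeff s - algebraMap (inftyRing F) (inftyIntegers F K) (constHom F d) ∈ P := by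
    have := P.add_mem ha (algebraMap_mem_of_mem_primeInfty P hd)
    rwa [map_sub, sub_add_sub_cancel] at this
  have hwp : w.coeff s ^ p - algebraMap (inftyRing F) (inftyIntegers F K) (constHom F d) ^ p ∈ P := by
    rw [← sub_pow_char]
    exact P.pow_mem_of_mem hwd p (Fact.out : p.Prime).pos
  have hAS := pow_sub_sub_mem (P := P) (lift_pow_sub_eq_carry hy hw hst)
    fun i hi => algebraMap_mem_of_mem_primeInfty P (hb i hi)
  have hbc' := algebraMap_mem_of_mem_primeInfty P hbc
  have hmem : algebraMap (inftyRing F) (inftyIntegers F K) (constHom F (d ^ p - d - c)) ∈ P := by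
    have := P.add_mem (P.add_mem (P.sub_mem hwd hwp) hAS) hbc'
    simp only [map_sub, map_pow] at this ⊢
    convert this using 1
    ring
  rw [← P.mem_of_liesOver (primeInfty F)] at hmem
  have hne : d ^ p - d - c ≠ 0 := fun h => hc ⟨d, sub_eq_zero.1 h⟩
  exact (IsLocalRing.mem_maximalIdeal _).1 hmem ((IsUnit.mk0 _ hne).map (constHom F))

end groups

end WittExt

end

theorem proposition5p3p2 {p : ℕ} [Fact p.Prime] {F : Type*} [Field F] [Finite F] [CharP F p]
    {K : Type*} [Field K] [Algebra (RatFunc F) K] [IsGalois (RatFunc F) K] {n r : ℕ}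
    -- `K / F(T)` is cyclic of degree `p ^ n`, with a generator `σ` of its Galois group
    (hdeg : Module.finrank (RatFunc F) K = p ^ n)
    (σ : Gal(K/RatFunc F)) (hσ : Subgroup.zpowers σ = ⊤)
    -- `K = F(T)(y)` with `y ^ p - y = β` in `W_n(K)`, where `β` is given in normal form
    (N : WittExt.NormalForm p F n r) (y : TruncatedWittVector p n K)
    (hy : WittExt.powP y - y = WittExt.mapCoeff K N.beta)
    (hK : IntermediateField.adjoin (RatFunc F) (Set.range fun j => y.coeff j) = ⊤)
    -- the shape of `μ = (f₁, …, fₙ)`; the index `j : Fin n` stands for the component `j + 1`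
    {s t : ℕ} (hst : s ≤ t) (htn : t ≤ n)
    (hzero : ∀ j : Fin n, (j : ℕ) < s → N.f j = 0)
    (hconst : ∀ j : Fin n, (j : ℕ) = s → s < t →
      ∃ c : F, c ∉ WittExt.artinSchreierImage p F ∧ N.f j = Polynomial.C c)
    (hconsts : ∀ j : Fin n, (j : ℕ) < t → ∃ c : F, N.f j = Polynomial.C c)
    (hnonconst : ∀ j : Fin n, (j : ℕ) = t → ¬ ∃ c : F, N.f j = Polynomial.C c) :
    -- the decomposition number: the number of primes of `K` above `𝔭_∞`
    ((WittExt.primeInfty F).primesOver (WittExt.inftyIntegers F K)).ncard = p ^ s ∧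
    ∀ 𝔓 ∈ (WittExt.primeInfty F).primesOver (WittExt.inftyIntegers F K),
      𝔓.ramificationIdx (WittExt.inftyRing F) = p ^ (n - t) ∧
      𝔓.inertiaDeg (WittExt.inftyRing F) = p ^ (t - s) ∧
      𝔓.inertia Gal(K/RatFunc F) = Subgroup.zpowers (σ ^ p ^ t) ∧
      MulAction.stabilizer Gal(K/RatFunc F) 𝔓 = Subgroup.zpowers (σ ^ p ^ s) := by
  open WittExt WittVector in
  have hp : p.Prime := Fact.out
  have : FiniteDimensional (RatFunc F) K :=
    FiniteDimensional.of_finrank_pos (hdeg ▸ pow_pos hp.pos n)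
  have : CharP K p := charP_of_injective_algebraMap (algebraMap (RatFunc F) K).injective p
  have hcard : Nat.card Gal(K/RatFunc F) = p ^ n := by
    rw [IsGalois.card_aut_eq_finrank, hdeg]
  obtain ⟨b, z, hbz, hz0, hzt, hbres⟩ := N.exists_integral_add_truncate_eq_beta hconsts
  rw [← hbz] at hy
  have hbot := levelSubgroup_eq_bot hK
  have hfix : ∀ m < n, ∀ g ∈ levelSubgroup (RatFunc F) y.out.coeff m,
      (g (y.out.coeff m) - y.out.coeff m) ^ p = g (y.out.coeff m) - y.out.coeff m :=
    fun m hm g hg => pow_sub_eq_self_of_mem_levelSubgroup (pow_sub_eq_carry hy hm) hg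
  -- The case m = t is included: the first possibly nonzero component of `z` enters additively.
  have hAS : ∀ m < n, m ≤ t → y.out.coeff m ^ p - y.out.coeff m =
      carry m y.out (map (algebraMap (inftyRing F) K) b) +
        algebraMap (RatFunc F) K (z.coeff m) := by
    intro m hmn hmt
    have hmap : map (algebraMap (RatFunc F) K) (map (algebraMap (inftyRing F) (RatFunc F)) b + z) =
        map (algebraMap (inftyRing F) K) b + map (algebraMap (RatFunc F) K) z := by
      rw [map_add]
      congr 1
    rw [pow_sub_eq_carry hy hmn, hmap, carry_add_of_forall_lt_eq_zero, map_coeff]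
    intro i hi
    rw [map_coeff, hz0 i (hi.trans_le hmt), map_zero]
  have hASb : ∀ m < t, y.out.coeff m ^ p - y.out.coeff m =
      carry m y.out (map (algebraMap (inftyRing F) K) b) := by
    intro m hm
    rw [hAS m (hm.trans_le htn) hm.le, hz0 m hm, map_zero, add_zero]
  have hmem : ∀ i : Fin n, (i : ℕ) < t → ∀ c : F, N.f i = Polynomial.C c →
      b.coeff i - constHom F c ∈ primeInfty F := by
    intro i hi c hc
    rw [← IsLocalRing.residue_eq_zero_iff, map_sub, hbres i hi c hc, sub_self]
  have hbs : ∀ i < s, b.coeff i ∈ primeInfty F := by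
    intro i hi
    have hin : i < n := hi.trans_le (hst.trans htn)
    simpa using hmem ⟨i, hin⟩ (hi.trans_le hst) 0 (by rw [hzero ⟨i, hin⟩ hi, Polynomial.C_0])
  obtain ⟨w, hw⟩ := exists_integral_lift (B := inftyIntegers F K) hASb
  have hI : ∀ P : Ideal (inftyIntegers F K), P.IsPrime → P.LiesOver (primeInfty F) →
      P.inertia Gal(K/RatFunc F) = levelSubgroup (RatFunc F) y.out.coeff t := by
    intro P _ _
    refine eq_levelSubgroup hcard hσ hbot hfix htn
      (inertia_le_levelSubgroup P (fun m hm => hfix m (hm.trans_le htn)) hw) fun htn' hle => ?_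
    have hdeg0 : 0 < (N.f ⟨t, htn'⟩).natDegree := by
      refine Nat.pos_of_ne_zero fun h0 => hnonconst ⟨t, htn'⟩ rfl ?_
      exact ⟨_, Polynomial.eq_C_of_natDegree_eq_zero h0⟩
    refine N.not_dvd_natDegree ⟨t, htn'⟩ hdeg0
      (dvd_natDegree_of_inertia_le hp.one_lt P hle
        (fun g hg => (mem_levelSubgroup_succ.1 hg).2) hdeg0
        (u := carry t w (map (algebraMap (inftyRing F) (inftyIntegers F K)) b)) ?_)
    rw [hAS t htn' le_rfl, hzt ⟨t, htn'⟩ rfl, carry_eq_algebraMap b hw le_rfl]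
  have hD : ∀ P : Ideal (inftyIntegers F K), P.IsPrime → P.LiesOver (primeInfty F) →
      MulAction.stabilizer Gal(K/RatFunc F) P = levelSubgroup (RatFunc F) y.out.coeff s := by
    intro P _ _
    refine eq_levelSubgroup hcard hσ hbot hfix (hst.trans htn)
      (stabilizer_le_levelSubgroup P (fun m hm => hfix m (hm.trans_le (hst.trans htn)))
        (fun m hm => hASb m (hm.trans_le hst)) (fun j hj => hw j (hj.trans_le hst)) hbs)
      fun hsn hle => ?_
    rcases hst.lt_or_eq with hlt | rfl
    · obtain ⟨c, hc, hfc⟩ := hconst ⟨s, hsn⟩ rfl hlt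
      exact not_stabilizer_le_levelSubgroup P hASb hw hlt hbs hc
        (hmem ⟨s, hsn⟩ hlt c hfc) hle
    -- When s = t, inertia would lie in level t + 1, which is smaller than the level t it equals.
    · have h1 := (Ideal.inertia_le_stabilizer (M := Gal(K/RatFunc F)) P).trans hle
      rw [hI P ‹_› ‹_›] at h1
      have h2 := Subgroup.card_le_of_le h1
      rw [card_levelSubgroup hcard hbot hfix htn, card_levelSubgroup hcard hbot hfix hsn] at h2
      exact ((Nat.pow_lt_pow_right hp.one_lt (by omega)).trans_le h2).false
  let := Ideal.Quotient.field (primeInfty F)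
  have hcI : ∀ P : Ideal (inftyIntegers F K), P.IsPrime → P.LiesOver (primeInfty F) →
      Nat.card (P.inertia Gal(K/RatFunc F)) = p ^ (n - t) := by
    intro P h1 h2
    rw [hI P h1 h2, card_levelSubgroup hcard hbot hfix htn]
  have hf : ∀ P : Ideal (inftyIntegers F K), P.IsPrime → P.LiesOver (primeInfty F) →
      P.inertiaDeg (inftyRing F) = p ^ (t - s) := by
    intro P h1 h2
    have h := Ideal.card_stabilizer_eq_card_inertia_mul_finrank (G := Gal(K/RatFunc F))
      (primeInfty F) P
    rw [hcI P h1 h2, hD P h1 h2, card_levelSubgroup hcard hbot hfix (hst.trans htn),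
      show n - s = (n - t) + (t - s) by omega, pow_add] at h
    exact (Nat.eq_of_mul_eq_mul_left (pow_pos hp.pos _) h).symm
  refine ⟨?_, fun P ⟨h1, h2⟩ => ⟨?_, hf P h1 h2, ?_, ?_⟩⟩
  · have : FaithfulSMul (inftyRing F) (inftyIntegers F K) :=
      Module.isTorsionFree_iff_faithfulSMul.1 inferInstance
    obtain ⟨P, h1, h2⟩ : Nonempty ((primeInfty F).primesOver (inftyIntegers F K)) := inferInstance
    have h := Ideal.ncard_primesOver_mul_card_inertia_mul_finrank (G := Gal(K/RatFunc F))
      (primeInfty F) P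
    rw [hcI P h1 h2, hf P h1 h2, hcard, mul_assoc, ← pow_add] at h
    refine Nat.eq_of_mul_eq_mul_right (pow_pos hp.pos ((n - t) + (t - s))) (h.trans ?_)
    rw [← pow_add]
    congr 1
    omega
  · rw [← hcI P h1 h2, Ideal.card_inertia_eq_ramificationIdxIn (primeInfty F) P,
      Ideal.ramificationIdxIn_eq_ramificationIdx (primeInfty F) P Gal(K/RatFunc F)]
  · rw [hI P h1 h2, levelSubgroup_eq_zpowers hcard hσ hbot hfix htn]
  · rw [hD P h1 h2, levelSubgroup_eq_zpowers hcard hσ hbot hfix (hst.trans htn)]
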